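/- For permutations $\pi\in S_n$ and $\alpha\in S_m$, written in one-line notation, say that $\pi$ contains the pattern $\alpha$ if there are indices $i_1<i_2<\dots<i_m$ such that $\pi_{i_1}\pi_{i_2}\cdots\pi_{i_m}$ is in the same relative order as $\alpha_1\alpha_2\cdots\alpha_m$; otherwise $\pi$ avoids $\alpha$. Let $d_n(\alpha)$ be the number of derangements (permutations without fixed points) in $S_n$ that avoid $\alpha$. Call $\alpha,\beta\in S_m$ $D$-Wilf equivalent if $d_n(\alpha)=d_n(\beta)$ for all $n\ge m$; the equivalence classes of this relation on $S_m$ are the $D$-Wilf classes of patterns of length $m$. **Theorem.** There are exactly three $D$-Wilf classes of patterns of length $3$, namely $\{132,213,321\}$, $\{231,312\}$ and $\{123\}$. -/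

import Mathlib

namespace RestrictedDerangements

/-- `π` contains the pattern `α`: there are positions `i 0 < ⋯ < i (m - 1)` at which the entries of
`π` are in the same relative order as the entries of `α`. Permutations of `{1, …, n}` are modelled
as permutations of `Fin n`, so positions and values are shifted by one. -/
def Contains {m n : ℕ} (π : Equiv.Perm (Fin n)) (α : Equiv.Perm (Fin m)) : Prop :=
  ∃ i : Fin m → Fin n, StrictMono i ∧ ∀ a b : Fin m, π (i a) < π (i b) ↔ α a < α b

/-- `D_n(T)`: the derangements in `S_n` that avoid every pattern in `T ⊆ S_m`. -/
def avoidingDerangements {m : ℕ} (n : ℕ) (T : Set (Equiv.Perm (Fin m))) :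
    Set (Equiv.Perm (Fin n)) :=
  {π | π ∈ derangements (Fin n) ∧ ∀ α ∈ T, ¬ Contains π α}

/-- `d_n(T) = |D_n(T)|`. -/
noncomputable def d {m : ℕ} (n : ℕ) (T : Set (Equiv.Perm (Fin m))) : ℕ :=
  (avoidingDerangements n T).ncard

/-- `D`-Wilf equivalence of sets of patterns of length `m`: `d_n(S₁) = d_n(S₂)` for all `n ≥ m`. -/
def DWilf (m : ℕ) : Setoid (Set (Equiv.Perm (Fin m))) where
  r S₁ S₂ := ∀ n, m ≤ n → d n S₁ = d n S₂
  iseqv :=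
    ⟨fun _ _ _ => rfl, fun h n hn => (h n hn).symm, fun h k n hn => (h n hn).trans (k n hn)⟩

/-- `D`-Wilf equivalence of single patterns: `α` is identified with `{α}`. -/
def patternDWilf (m : ℕ) : Setoid (Equiv.Perm (Fin m)) :=
  (DWilf m).comap fun α => {α}

/-! The six patterns of length three, in one-line notation (with entries shifted by one). -/

def p123 : Equiv.Perm (Fin 3) := ⟨![0, 1, 2], ![0, 1, 2], by decide, by decide⟩

def p132 : Equiv.Perm (Fin 3) := ⟨![0, 2, 1], ![0, 2, 1], by decide, by decide⟩

def p213 : Equiv.Perm (Fin 3) := ⟨![1, 0, 2], ![1, 0, 2], by decide, by decide⟩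

def p231 : Equiv.Perm (Fin 3) := ⟨![1, 2, 0], ![2, 0, 1], by decide, by decide⟩

def p312 : Equiv.Perm (Fin 3) := ⟨![2, 0, 1], ![1, 2, 0], by decide, by decide⟩

def p321 : Equiv.Perm (Fin 3) := ⟨![2, 1, 0], ![2, 1, 0], by decide, by decide⟩

end RestrictedDerangements

/-! ### Permutations as functions on `ℕ`, and counting them -/

namespace RestrictedDerangements

/-! The classes are separated by small values: d_3 is 2, 1, 2 for 321, 231, 123, and d_4 is 6, 7 for
321, 123. Inside the classes, reverse-complement carries 132 to 213 and inversion carries 231 to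
312, both preserving derangements. The substance is d_n(321) = d_n(132).

For either of these two patterns let a_n count the avoiders and D_n the derangements among them.
Then a_n = D_n + ∑_{s<n} D_s a_{n-1-s} (`count_eq_add_sum`): take out of π its first fixed point
together with a block S of s entries just before it, which has no fixed point; the rest closes up to
an avoider σ of length n-1-s. For 321 the block is everything before the fixed point, and π is a
direct sum. For 132 the block starts at a position r which is recovered from σ as `crossing`, so
that (S, σ) determines π.

The numbers a_n agree for the two patterns because a refinement by a monotonicity condition
satisfies the same first-entry recursion (`count_incBelow_eq_count_incAbove`). Since D_n enters the
fixed-point recursion with coefficient 1, equality of D_n follows by strong induction. Functions on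
`ℕ` replace permutations of `Fin n` so that changes of length need no casts. -/

/-- `f` is injective and fixes every `x ≥ n`; such functions encode the permutations of
`{0, …, n - 1}`. -/
def IsPermOn (n : ℕ) (f : ℕ → ℕ) : Prop :=
  Function.Injective f ∧ ∀ x, n ≤ x → f x = x

namespace IsPermOn

variable {n : ℕ} {f : ℕ → ℕ}

lemma ne (hf : IsPermOn n f) {x y : ℕ} (h : x ≠ y) : f x ≠ f y :=
  fun e => h (hf.1 e)

lemma lt (hf : IsPermOn n f) {x : ℕ} (hx : x < n) : f x < n := by
  by_contra h
  have := hf.1 (hf.2 (f x) (by omega))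
  omega

lemma exists_eq (hf : IsPermOn n f) (y : ℕ) : ∃ x, f x = y := by
  by_cases hy : y < n
  · obtain ⟨x, -, hx⟩ := Finset.surj_on_of_inj_on_of_card_le (s := Finset.range n)
      (t := Finset.range n) (fun x _ => f x)
      (fun x hx => Finset.mem_range.2 (hf.lt (Finset.mem_range.1 hx)))
      (fun _ _ _ _ h => hf.1 h) le_rfl y (Finset.mem_range.2 hy)
    exact ⟨x, hx.symm⟩
  · exact ⟨y, hf.2 y (by omega)⟩

end IsPermOn

/-- The function on `ℕ` that extends a permutation of `Fin n` by the identity. -/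
def extend {n : ℕ} (π : Equiv.Perm (Fin n)) (x : ℕ) : ℕ :=
  if h : x < n then π ⟨x, h⟩ else x

lemma extend_val {n : ℕ} (π : Equiv.Perm (Fin n)) (x : Fin n) : extend π x = π x := by
  simp [extend]

lemma extend_of_lt {n : ℕ} (π : Equiv.Perm (Fin n)) {x : ℕ} (h : x < n) :
    extend π x = π ⟨x, h⟩ := by
  simp [extend, h]

lemma extend_of_le {n : ℕ} (π : Equiv.Perm (Fin n)) {x : ℕ} (h : n ≤ x) :
    extend π x = x := by
  simp [extend, h]

lemma isPermOn_extend {n : ℕ} (π : Equiv.Perm (Fin n)) : IsPermOn n (extend π) := by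
  refine ⟨fun x y h => ?_, fun x hx => extend_of_le π hx⟩
  rcases lt_or_ge x n with hx | hx <;> rcases lt_or_ge y n with hy | hy
  · rw [extend_of_lt π hx, extend_of_lt π hy, Fin.val_inj, π.injective.eq_iff] at h
    simpa using h
  · rw [extend_of_lt π hx, extend_of_le π hy] at h
    omega
  · rw [extend_of_le π hx, extend_of_lt π hy] at h
    omega
  · rwa [extend_of_le π hx, extend_of_le π hy] at h

lemma extend_bijective (n : ℕ) : Function.Bijective
    (fun π : Equiv.Perm (Fin n) => (⟨extend π, isPermOn_extend π⟩ : {f // IsPermOn n f})) := by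
  constructor
  · intro π τ h
    ext x
    rw [← extend_val, ← extend_val]
    exact congrFun (congrArg Subtype.val h) x
  · rintro ⟨f, hf⟩
    let g : Fin n → Fin n := fun x => ⟨f x, hf.lt x.2⟩
    have hg : Function.Injective g := fun x y h => Fin.ext (hf.1 (congrArg Fin.val h))
    refine ⟨Equiv.ofBijective g (Finite.injective_iff_bijective.1 hg), ?_⟩
    ext x
    rcases lt_or_ge x n with hx | hx
    · simp [extend_of_lt, hx, g]
    · simp [extend_of_le, hx, hf.2]

/-- Permutations of `Fin n` as functions on `ℕ`. -/
noncomputable def permEquiv (n : ℕ) : Equiv.Perm (Fin n) ≃ {f // IsPermOn n f} :=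
  Equiv.ofBijective _ (extend_bijective n)

instance (n : ℕ) : Finite {f // IsPermOn n f} := Finite.of_equiv _ (permEquiv n)

instance (n : ℕ) (Q : (ℕ → ℕ) → Prop) : Finite {f // IsPermOn n f ∧ Q f} :=
  Finite.of_injective (fun f => (⟨f.1, f.2.1⟩ : {f // IsPermOn n f}))
    fun _ _ h => Subtype.ext (congrArg (fun u => u.1) h)

/-- The number of permutations of `{0, …, n - 1}` that satisfy `Q`. -/
noncomputable def count (n : ℕ) (Q : (ℕ → ℕ) → Prop) : ℕ :=
  Nat.card {f // IsPermOn n f ∧ Q f}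

lemma count_congr {n : ℕ} {Q R : (ℕ → ℕ) → Prop} (h : ∀ f, IsPermOn n f → (Q f ↔ R f)) :
    count n Q = count n R :=
  Nat.card_congr (Equiv.subtypeEquivRight fun f => and_congr_right (h f))

lemma count_eq_zero {n : ℕ} {Q : (ℕ → ℕ) → Prop} (h : ∀ f, IsPermOn n f → ¬ Q f) :
    count n Q = 0 := by
  have : IsEmpty {f // IsPermOn n f ∧ Q f} := ⟨fun f => h f.1 f.2.1 f.2.2⟩
  exact Nat.card_of_isEmpty

lemma ncard_perm_eq_count {n : ℕ} (Q : (ℕ → ℕ) → Prop) :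
    {π : Equiv.Perm (Fin n) | Q (extend π)}.ncard = count n Q := by
  rw [← Nat.card_coe_set_eq, count]
  exact Nat.card_congr (((permEquiv n).subtypeEquiv (p := fun π => Q (extend π))
    (q := fun f => Q f.1) (fun π => Iff.rfl)).trans
      (Equiv.subtypeSubtypeEquivSubtypeInter (IsPermOn n) Q))

/-- No decreasing subsequence of length three. -/
def Avoids321 (f : ℕ → ℕ) : Prop :=
  ∀ a b c, a < b → b < c → f b < f a → f c < f b → False

/-- No subsequence in the relative order of `132`. -/
def Avoids132 (f : ℕ → ℕ) : Prop :=
  ∀ a b c, a < b → b < c → f a < f c → f c < f b → False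

/-- No fixed point below `n`. -/
def FixedFree (n : ℕ) (f : ℕ → ℕ) : Prop :=
  ∀ x < n, f x ≠ x

/-! ### Gluing a block and a fixed point into a permutation -/

/-- `σ` with a block `S` of length `s`, followed by a fixed point, inserted between the positions
and values `< r` and the positions and values `≥ r`. -/
def glue (r s : ℕ) (S σ : ℕ → ℕ) (x : ℕ) : ℕ :=
  if x < r then (if σ x < r then σ x else σ x + (s + 1))
  else if x < r + s then r + S (x - r)
  else if x = r + s then r + s
  else if σ (x - (s + 1)) < r then σ (x - (s + 1)) else σ (x - (s + 1)) + (s + 1)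

section glue

variable {r s m : ℕ} {S σ : ℕ → ℕ}

lemma glue_of_lt (hr : ∀ x < r, r ≤ σ x) {x : ℕ} (hx : x < r) :
    glue r s S σ x = σ x + (s + 1) := by
  have := hr x hx
  simp [glue, hx, Nat.not_lt.2 this]

lemma glue_block {x : ℕ} (hx : x < s) : glue r s S σ (r + x) = r + S x := by
  simp [glue, hx]

lemma glue_fixed : glue r s S σ (r + s) = r + s := by
  simp [glue]

lemma glue_of_gt {x : ℕ} (hx : r ≤ x) : glue r s S σ (x + (s + 1)) =
    if σ x < r then σ x else σ x + (s + 1) := by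
  have h1 : ¬ x + (s + 1) < r := by omega
  have h2 : ¬ x + (s + 1) < r + s := by omega
  have h3 : ¬ x + (s + 1) = r + s := by omega
  simp only [glue, h1, h2, h3, if_false, Nat.add_sub_cancel]

/-- The four kinds of positions of a glued permutation. -/
lemma glue_cases (r s x : ℕ) : x < r ∨ (∃ y < s, x = r + y) ∨ x = r + s ∨
    ∃ y, r ≤ y ∧ x = y + (s + 1) := by
  rcases lt_or_ge x r with h | h
  · exact .inl h
  rcases lt_trichotomy x (r + s) with h' | h' | h'
  · exact .inr (.inl ⟨x - r, by omega, by omega⟩)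
  · exact .inr (.inr (.inl h'))
  · exact .inr (.inr (.inr ⟨x - (s + 1), by omega, by omega⟩))

lemma isPermOn_glue (hS : IsPermOn s S) (hσ : IsPermOn m σ) (hrm : r ≤ m)
    (hr : ∀ x < r, r ≤ σ x) : IsPermOn (m + s + 1) (glue r s S σ) := by
  constructor
  · intro x y h
    have hx := @hS.lt
    have hs := hS.1
    have hs' := hσ.1
    rcases glue_cases r s x with h1 | ⟨x, h1, rfl⟩ | rfl | ⟨x, h1, rfl⟩ <;>
    rcases glue_cases r s y with h2 | ⟨y, h2, rfl⟩ | rfl | ⟨y, h2, rfl⟩ <;>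
    simp only [glue_of_lt hr, glue_block, glue_fixed, glue_of_gt, *] at h <;>
    grind [Function.Injective]
  · intro x hx
    obtain ⟨y, rfl⟩ : ∃ y, x = y + (s + 1) := ⟨x - (s + 1), by omega⟩
    rw [glue_of_gt (by omega), hσ.2 y (by omega), if_neg (by omega)]

/-- Entries before the block jump above it, and a fixed point inside the block would be one of `S`.
Hence `r + s` is the first fixed point of the glued permutation. -/
lemma fixedFree_glue (hr : ∀ x < r, r ≤ σ x) (hF : FixedFree s S) :
    FixedFree (r + s) (glue r s S σ) := by
  intro x hx
  rcases glue_cases r s x with h1 | ⟨x, h1, rfl⟩ | rfl | ⟨x, h1, rfl⟩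
  · rw [glue_of_lt hr h1]
    have := hr x h1
    omega
  · rw [glue_block h1]
    have := hF x h1
    omega
  · omega
  · omega

lemma glue_injective {S' σ' : ℕ → ℕ} (hS : IsPermOn s S) (hS' : IsPermOn s S')
    (hr : ∀ x < r, r ≤ σ x) (hr' : ∀ x < r, r ≤ σ' x)
    (h : glue r s S σ = glue r s S' σ') : S = S' ∧ σ = σ' := by
  constructor
  · ext x
    rcases lt_or_ge x s with hx | hx
    · have := congrFun h (r + x)
      rw [glue_block hx, glue_block hx] at this
      omega
    · rw [hS.2 x hx, hS'.2 x hx]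
  · ext x
    rcases lt_or_ge x r with hx | hx
    · have := congrFun h x
      rw [glue_of_lt hr hx, glue_of_lt hr' hx] at this
      omega
    · have := congrFun h (x + (s + 1))
      rw [glue_of_gt hx, glue_of_gt hx] at this
      split_ifs at this <;> omega

/-- The sum `r + s` is read off as the first fixed point, and then `r` as the first position whose
value is at most `r + s`. -/
lemma glue_index_unique {r' s' : ℕ} {S' σ' : ℕ → ℕ} (hS : IsPermOn s S) (hS' : IsPermOn s' S')
    (hF : FixedFree s S) (hF' : FixedFree s' S')
    (hr : ∀ x < r, r ≤ σ x) (hr' : ∀ x < r', r' ≤ σ' x)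
    (h : glue r s S σ = glue r' s' S' σ') : r = r' ∧ s = s' := by
  have h1 : r + s = r' + s' := by
    have a := fixedFree_glue hr hF (r' + s')
    have b := fixedFree_glue hr' hF' (r + s)
    rw [h, glue_fixed] at a
    rw [← h, glue_fixed] at b
    rcases lt_trichotomy (r + s) (r' + s') with h | h | h
    · exact absurd rfl (b h)
    · exact h
    · exact absurd rfl (a h)
  have key : ∀ {r s : ℕ} {S σ : ℕ → ℕ}, IsPermOn s S → glue r s S σ r ≤ r + s := by
    intro r s S σ hS
    rcases Nat.eq_zero_or_pos s with rfl | hs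
    · exact (glue_fixed (s := 0)).le
    · have := glue_block (r := r) (S := S) (σ := σ) hs
      have := hS.lt hs
      simp_all
      omega
  have k1 := key (r := r) (σ := σ) hS
  have k2 := key (r := r') (σ := σ') hS'
  rcases lt_trichotomy r r' with h2 | h2 | h2
  · rw [h, glue_of_lt hr' h2] at k1
    have := hr' r h2
    omega
  · omega
  · rw [← h, glue_of_lt hr h2] at k2
    have := hr r' h2
    omega

end glue

/-- A permutation that respects the blocks given by `r` and a fixed point `r + s` is glued from
smaller permutations. -/
lemma exists_eq_glue {r s m : ℕ} {π : ℕ → ℕ} (hπ : IsPermOn (m + s + 1) π) (hrm : r ≤ m)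
    (hi : π (r + s) = r + s)
    (h1 : ∀ x < r, r + s < π x) (h2 : ∀ x < s, r ≤ π (r + x) ∧ π (r + x) < r + s)
    (h3 : ∀ x, r + s < x → π x < r ∨ r + s < π x) :
    ∃ S σ, IsPermOn s S ∧ IsPermOn m σ ∧ (∀ x < r, r ≤ σ x) ∧ π = glue r s S σ := by
  let S : ℕ → ℕ := fun x => if x < s then π (r + x) - r else x
  let σ : ℕ → ℕ := fun x => if x < r then π x - (s + 1) else
    if π (x + (s + 1)) < r then π (x + (s + 1)) else π (x + (s + 1)) - (s + 1)
  have hσ1 : ∀ x, x < r → σ x + (s + 1) = π x := by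
    intro x hx
    have := h1 x hx
    simp only [σ, hx, if_true]
    omega
  have hσ2 : ∀ x, r ≤ x → (if σ x < r then σ x else σ x + (s + 1)) = π (x + (s + 1)) := by
    intro x hx
    have := h3 (x + (s + 1)) (by omega)
    simp only [σ, Nat.not_lt.2 hx, if_false]
    split_ifs <;> omega
  have hr : ∀ x < r, r ≤ σ x := fun x hx => by
    have := h1 x hx
    have := hσ1 x hx
    omega
  have hS1 : ∀ x < s, r + S x = π (r + x) := fun x hx => by
    have := h2 x hx
    simp only [S, hx, if_true]
    omega
  have hinj : ∀ {x y}, π x = π y → x = y := fun h => hπ.1 h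
  refine ⟨S, σ, ⟨fun x y h => ?_, fun x hx => if_neg (by omega)⟩,
    ⟨fun x y h => ?_, fun x hx => ?_⟩, hr, ?_⟩
  · rcases lt_or_ge x s with hx | hx <;> rcases lt_or_ge y s with hy | hy
    · have := hinj ((hS1 x hx).symm.trans (h ▸ hS1 y hy))
      omega
    · have := h2 x hx
      have := hS1 x hx
      have : S y = y := if_neg (by omega)
      omega
    · have := h2 y hy
      have := hS1 y hy
      have : S x = x := if_neg (by omega)
      omega
    · simpa [S, Nat.not_lt.2 hx, Nat.not_lt.2 hy] using h
  · rcases lt_or_ge x r with hx | hx <;> rcases lt_or_ge y r with hy | hy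
    · exact hinj ((hσ1 x hx).symm.trans (h ▸ hσ1 y hy))
    · have := hr x hx
      have e := hσ2 y hy
      rw [if_neg (by omega), ← h, hσ1 x hx] at e
      have := hinj e
      omega
    · have := hr y hy
      have e := hσ2 x hx
      rw [if_neg (by omega), h, hσ1 y hy] at e
      have := hinj e
      omega
    · have e := hσ2 x hx
      rw [h, hσ2 y hy] at e
      have := hinj e
      omega
  · have e := hπ.2 (x + (s + 1)) (by omega)
    simp only [σ, e]
    split_ifs <;> omega
  · ext x
    rcases glue_cases r s x with h | ⟨x, h, rfl⟩ | rfl | ⟨x, h, rfl⟩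
    · rw [glue_of_lt hr h, hσ1 x h]
    · rw [glue_block h, hS1 x h]
    · rw [glue_fixed, hi]
    · rw [glue_of_gt h, hσ2 x h]

/-! ### The recursion on the first fixed point -/

/-- Splitting off the first fixed point: a class of permutations which is stable under gluing along
an index `ρ m σ`, and each of whose members with a fixed point arises so, satisfies the recursion
of the Fine numbers. -/
lemma count_eq_add_sum (Q : (ℕ → ℕ) → Prop) (ρ : ℕ → (ℕ → ℕ) → ℕ)
    (hρ : ∀ m σ, ρ m σ ≤ m ∧ ∀ x < ρ m σ, ρ m σ ≤ σ x)
    (hglue : ∀ s m S σ, IsPermOn s S → IsPermOn m σ → Q S → Q σ → Q (glue (ρ m σ) s S σ))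
    (hsplit : ∀ n π i, IsPermOn n π → Q π → i < n → π i = i → (∀ x < i, π x ≠ x) →
      ∃ s m S σ, n = m + s + 1 ∧ IsPermOn s S ∧ IsPermOn m σ ∧ Q S ∧ Q σ ∧ i = ρ m σ + s ∧
        π = glue (ρ m σ) s S σ) (n : ℕ) :
    count n Q = count n (fun f => Q f ∧ FixedFree n f) +
      ∑ s ∈ Finset.range n, count s (fun f => Q f ∧ FixedFree s f) * count (n - 1 - s) Q := by
  let g : (Σ s : Fin n, {f // IsPermOn s f ∧ Q f ∧ FixedFree s f} ×
      {f // IsPermOn (n - 1 - s) f ∧ Q f}) →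
      {f // IsPermOn n f ∧ Q f ∧ ¬ FixedFree n f} := fun p =>
    ⟨glue (ρ (n - 1 - p.1) p.2.2.1) p.1 p.2.1.1 p.2.2.1, by
      obtain ⟨s, ⟨S, hS, hQS, -⟩, ⟨σ, hσ, hQσ⟩⟩ := p
      have h := hρ (n - 1 - s) σ
      refine ⟨?_, hglue _ _ _ _ hS hσ hQS hQσ, fun hF =>
        hF (ρ (n - 1 - s) σ + s) (by have := s.2; omega) glue_fixed⟩
      have := isPermOn_glue hS hσ h.1 h.2
      have e : n - 1 - s + s + 1 = n := by omega
      rwa [e] at this⟩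
  have hg : Function.Bijective g := by
    constructor
    · rintro ⟨⟨s, hs⟩, ⟨S, hS, hQS, hF⟩, ⟨σ, hσ, hQσ⟩⟩ ⟨⟨s', hs'⟩, ⟨S', hS', hQS', hF'⟩,
        ⟨σ', hσ', hQσ'⟩⟩ h
      replace h := congrArg Subtype.val h
      simp only [g] at h
      dsimp only at hS hS' hF hF' hσ hσ'
      obtain ⟨e1, e2⟩ := glue_index_unique hS hS' hF hF' (hρ _ σ).2 (hρ _ σ').2 h
      subst e2
      rw [← e1] at h
      obtain ⟨rfl, rfl⟩ := glue_injective hS hS' (hρ _ σ).2 (e1 ▸ (hρ _ σ').2) h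
      rfl
    · rintro ⟨π, hπ, hQ, hF⟩
      have hF' : ∃ x, x < n ∧ π x = x := by
        simpa [FixedFree] using hF
      classical
      obtain ⟨s, m, S, σ, hn, hS, hσ, hQS, hQσ, hi, he⟩ := hsplit n π (Nat.find hF') hπ hQ
        (Nat.find_spec hF').1 (Nat.find_spec hF').2
        (fun x hx e => Nat.find_min hF' hx ⟨hx.trans (Nat.find_spec hF').1, e⟩)
      obtain rfl : m = n - 1 - s := by omega
      refine ⟨⟨⟨s, by omega⟩, ⟨S, hS, hQS, ?_⟩, ⟨σ, hσ, hQσ⟩⟩, Subtype.ext he.symm⟩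
      -- A fixed point of `S` at `x` would give one of `π` before the first.
      intro x hx e
      refine Nat.find_min hF' (m := ρ (n - 1 - s) σ + x) (by dsimp only at hx; omega)
        ⟨?_, ?_⟩
      · have := (hρ (n - 1 - s) σ).1
        dsimp only at hx
        omega
      · rw [he, glue_block hx, e]
  have hsum : Nat.card {f // IsPermOn n f ∧ Q f ∧ ¬ FixedFree n f} =
      ∑ s ∈ Finset.range n, count s (fun f => Q f ∧ FixedFree s f) * count (n - 1 - s) Q := by
    rw [← Nat.card_congr (Equiv.ofBijective g hg), Nat.card_sigma, ← Fin.sum_univ_eq_sum_range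
      (fun s => count s (fun f => Q f ∧ FixedFree s f) * count (n - 1 - s) Q)]
    simp only [Nat.card_prod, count]
  rw [← hsum, count, count, ← Nat.card_sum]
  classical
  exact Nat.card_congr ((Equiv.sumCompl fun f : {f // IsPermOn n f ∧ Q f} =>
    FixedFree n f.1).symm.trans (Equiv.sumCongr
      ((Equiv.subtypeSubtypeEquivSubtypeInter (fun f => IsPermOn n f ∧ Q f) _).trans
        (Equiv.subtypeEquivRight fun f => by tauto))
      ((Equiv.subtypeSubtypeEquivSubtypeInter (fun f => IsPermOn n f ∧ Q f)
        (fun f => ¬ FixedFree n f)).trans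
        (Equiv.subtypeEquivRight fun f => by tauto))))

/-! ### Pattern avoidance under gluing -/

/-- Every permutation in the glued pieces occurs, in the same relative order, in the whole. -/
lemma block_lt_iff {r s : ℕ} {S σ : ℕ → ℕ} {x y : ℕ} (hx : x < s) (hy : y < s) :
    S x < S y ↔ glue r s S σ (r + x) < glue r s S σ (r + y) := by
  rw [glue_block hx, glue_block hy]
  omega

/-- The position in a glued permutation of the entry at position `x` of the outer permutation. -/
def shift (r s x : ℕ) : ℕ := if x < r then x else x + (s + 1)

lemma shift_lt_shift {r s x y : ℕ} : shift r s x < shift r s y ↔ x < y := by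
  unfold shift
  split_ifs <;> omega

/-- `shift` acts alike on positions and values, so it transports every pattern of `σ` into the glued
permutation. -/
lemma glue_shift {r s : ℕ} {S σ : ℕ → ℕ} (x : ℕ) :
    glue r s S σ (shift r s x) = shift r s (σ x) := by
  unfold shift
  split_ifs with h h'
  · simp [glue, h, h']
  · simp [glue, h, h']
  all_goals simp_all [glue_of_gt]

lemma Avoids321.outer {r s : ℕ} {S σ : ℕ → ℕ} (h : Avoids321 (glue r s S σ)) : Avoids321 σ :=
  fun a b c hab hbc h1 h2 => h _ _ _ (shift_lt_shift.2 hab) (shift_lt_shift.2 hbc)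
    (by rwa [glue_shift, glue_shift, shift_lt_shift])
    (by rwa [glue_shift, glue_shift, shift_lt_shift])

lemma Avoids132.outer {r s : ℕ} {S σ : ℕ → ℕ} (h : Avoids132 (glue r s S σ)) : Avoids132 σ :=
  fun a b c hab hbc h1 h2 => h _ _ _ (shift_lt_shift.2 hab) (shift_lt_shift.2 hbc)
    (by rwa [glue_shift, glue_shift, shift_lt_shift])
    (by rwa [glue_shift, glue_shift, shift_lt_shift])

/-- From `n` on, `f` is the identity and exceeds all earlier values. Both patterns end in a descent,
so their occurrences in `f` lie below `n`. -/
lemma IsPermOn.lt_of_inversion {n : ℕ} {f : ℕ → ℕ} (hf : IsPermOn n f) {b c : ℕ} (h : b < c)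
    (h' : f c < f b) : c < n := by
  by_contra hc
  rw [hf.2 c (by omega)] at h'
  rcases lt_or_ge b n with hb | hb
  · have := hf.lt hb
    omega
  · rw [hf.2 b hb] at h'
    omega

lemma Avoids321.block {r s : ℕ} {S σ : ℕ → ℕ} (hS : IsPermOn s S)
    (h : Avoids321 (glue r s S σ)) : Avoids321 S := by
  intro a b c hab hbc h1 h2
  have hc := hS.lt_of_inversion hbc h2
  exact h (r + a) (r + b) (r + c) (by omega) (by omega)
    ((block_lt_iff (by omega) (by omega)).1 h1) ((block_lt_iff (by omega) (by omega)).1 h2)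

lemma Avoids132.block {r s : ℕ} {S σ : ℕ → ℕ} (hS : IsPermOn s S)
    (h : Avoids132 (glue r s S σ)) : Avoids132 S := by
  intro a b c hab hbc h1 h2
  have hc := hS.lt_of_inversion hbc h2
  exact h (r + a) (r + b) (r + c) (by omega) (by omega)
    ((block_lt_iff (by omega) (by omega)).1 h1) ((block_lt_iff (by omega) (by omega)).1 h2)

lemma glue_zero_of_lt {s x : ℕ} {S σ : ℕ → ℕ} (h : x < s) : glue 0 s S σ x = S x := by
  simpa using glue_block (r := 0) (S := S) (σ := σ) h

lemma glue_zero_of_gt {s x : ℕ} {S σ : ℕ → ℕ} : glue 0 s S σ (x + (s + 1)) = σ x + (s + 1) := by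
  simpa using glue_of_gt (r := 0) (s := s) (S := S) (σ := σ) (Nat.zero_le x)

/-- With `r = 0` gluing is a direct sum, and no inversion joins two different summands; a 321
therefore lies inside `S` or inside `σ`. -/
lemma avoids321_glue {s : ℕ} {S σ : ℕ → ℕ} (hS : IsPermOn s S)
    (hS' : Avoids321 S) (hσ' : Avoids321 σ) : Avoids321 (glue 0 s S σ) := by
  intro a b c hab hbc h1 h2
  have hlt := @hS.lt
  have h0 := glue_fixed (r := 0) (s := s) (S := S) (σ := σ)
  rw [Nat.zero_add] at h0
  rcases lt_or_ge c s with hc | hc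
  · rw [glue_zero_of_lt (hbc.trans hc)] at h1 h2
    rw [glue_zero_of_lt (hab.trans (hbc.trans hc))] at h1
    rw [glue_zero_of_lt hc] at h2
    exact hS' a b c hab hbc h1 h2
  · have key : ∀ {x y}, x < y → glue 0 s S σ y < glue 0 s S σ x → s ≤ y →
        ∃ u v, x = u + (s + 1) ∧ y = v + (s + 1) := by
      intro x y hxy h hy
      rcases lt_trichotomy x s with hx | hx | hx
      · exfalso
        rw [glue_zero_of_lt hx] at h
        have := hlt hx
        rcases hy.eq_or_lt with rfl | hy
        · omega
        · obtain ⟨v, rfl⟩ : ∃ v, y = v + (s + 1) := ⟨y - (s + 1), by omega⟩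
          rw [glue_zero_of_gt] at h
          omega
      · exfalso
        obtain ⟨v, rfl⟩ : ∃ v, y = v + (s + 1) := ⟨y - (s + 1), by omega⟩
        rw [hx, glue_zero_of_gt] at h
        omega
      · exact ⟨x - (s + 1), y - (s + 1), by omega, by omega⟩
    obtain ⟨v, w, rfl, rfl⟩ := key hbc h2 hc
    obtain ⟨u, -, rfl, -⟩ := key hab h1 (by omega)
    rw [glue_zero_of_gt, glue_zero_of_gt] at h1 h2
    exact hσ' u v w (by omega) (by omega) (by omega) (by omega)

/-- This and the next two lemmas are the pigeonhole principle for `f`, used to locate values from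
one-sided information. -/
lemma IsPermOn.card_le {n : ℕ} {f : ℕ → ℕ} (hf : IsPermOn n f) {A B : Finset ℕ}
    (h : ∀ x, f x ∈ B → x ∈ A) : B.card ≤ A.card := by
  choose g hg using hf.exists_eq
  refine Finset.card_le_card_of_injOn g (fun y hy => h _ ((hg y).symm ▸ hy)) fun y _ z _ e => ?_
  rw [← hg y, e, hg z]

lemma IsPermOn.mem_of_mem {n : ℕ} {f : ℕ → ℕ} (hf : IsPermOn n f) {A B : Finset ℕ}
    (h : ∀ x, f x ∈ B → x ∈ A) (hc : A.card ≤ B.card) {x : ℕ} (hx : x ∈ A) : f x ∈ B := by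
  by_contra hxB
  have h1 := hf.card_le (A := A.erase x) (B := B) fun y hy =>
    Finset.mem_erase.2 ⟨fun e => hxB (e ▸ hy), h y hy⟩
  have h2 := Finset.card_erase_lt_of_mem hx
  omega

lemma IsPermOn.mem_of_apply_mem {n : ℕ} {f : ℕ → ℕ} (hf : IsPermOn n f) {A B : Finset ℕ}
    (h : ∀ x ∈ A, f x ∈ B) (hc : B.card ≤ A.card) {x : ℕ} (hx : f x ∈ B) : x ∈ A := by
  obtain ⟨y, hy, e⟩ := Finset.surj_on_of_inj_on_of_card_le (fun x _ => f x) h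
    (fun _ _ _ _ h => hf.1 h) hc _ hx
  exact hf.1 e ▸ hy

/-- An entry before `i` that exceeds `i` forces, by pigeonhole, a later entry below `i`; with the
fixed point between them they form a 321. -/
lemma Avoids321.lt_of_fixed {n i : ℕ} {π : ℕ → ℕ} (hπ : IsPermOn n π) (h : Avoids321 π)
    (hi : π i = i) {x : ℕ} (hx : x < i) : π x < i := by
  by_contra hlt
  have hne := hπ.ne hx.ne
  obtain ⟨y, hy, hy'⟩ : ∃ y, i < y ∧ π y < i := by
    by_contra! hcon
    refine hlt (Finset.mem_range.1 (hπ.mem_of_mem (A := Finset.range i) (fun y hy => ?_) le_rfl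
      (Finset.mem_range.2 hx)))
    rw [Finset.mem_range] at *
    by_contra hiy
    rcases (not_lt.1 hiy).eq_or_lt with rfl | h'
    · omega
    · exact absurd (hcon y h') (by omega)
  exact h x i y hx hy (by omega) (by omega)

/-- The recursion for `321`: a fixed point splits the permutation as a direct sum. -/
lemma count_avoids321 (n : ℕ) :
    count n Avoids321 = count n (fun f => Avoids321 f ∧ FixedFree n f) +
      ∑ s ∈ Finset.range n, count s (fun f => Avoids321 f ∧ FixedFree s f) *
        count (n - 1 - s) Avoids321 := by
  refine count_eq_add_sum Avoids321 (fun _ _ => 0) (fun m σ => ⟨by omega, by omega⟩)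
    (fun s m S σ hS _ h1 h2 => avoids321_glue hS h1 h2) (fun n π i hπ h hin hi _ => ?_) n
  have hlt : ∀ x < i, π x < i := fun x hx => h.lt_of_fixed hπ hi hx
  obtain ⟨m, rfl⟩ : ∃ m, n = m + i + 1 := ⟨n - i - 1, by omega⟩
  obtain ⟨S, σ, hS, hσ, -, rfl⟩ := exists_eq_glue (r := 0) hπ (Nat.zero_le m) (by simpa using hi)
    (by omega) (fun x hx => ⟨by omega, by simpa using hlt x hx⟩) (fun x hx => by
      right
      rw [Nat.zero_add] at *
      by_contra hle
      have hne := hπ.ne hx.ne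
      have : x ∈ Finset.range i := hπ.mem_of_apply_mem (B := Finset.range i)
        (fun y hy => Finset.mem_range.2 (hlt y (Finset.mem_range.1 hy))) le_rfl
        (Finset.mem_range.2 (by omega))
      rw [Finset.mem_range] at this
      omega)
  exact ⟨i, m, S, σ, rfl, hS, hσ, h.block hS, h.outer, by simp, rfl⟩

/-! ### The block decomposition for 132 -/

open Classical in
/-- The largest `k ≤ m` such that the first `k` entries of `σ` are all at least `k`. -/
noncomputable def crossing (m : ℕ) (σ : ℕ → ℕ) : ℕ :=
  Nat.findGreatest (fun k => ∀ x < k, k ≤ σ x) m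

lemma crossing_le (m : ℕ) (σ : ℕ → ℕ) : crossing m σ ≤ m := by
  classical exact Nat.findGreatest_le m

lemma le_of_lt_crossing (m : ℕ) (σ : ℕ → ℕ) : ∀ x < crossing m σ, crossing m σ ≤ σ x := by
  classical
  exact Nat.findGreatest_spec (P := fun k => ∀ x < k, k ≤ σ x) (Nat.zero_le m) (by omega)

lemma le_crossing {m k : ℕ} {σ : ℕ → ℕ} (hk : k ≤ m) (h : ∀ x < k, k ≤ σ x) :
    k ≤ crossing m σ := by
  classical exact Nat.le_findGreatest hk h

/-- If the crossing exceeded `r`, the entry at position `r` would exceed `r` while the value `r`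
came later, contradicting `hinc`. -/
lemma crossing_eq {m r : ℕ} {σ : ℕ → ℕ} (hσ : IsPermOn m σ) (hrm : r ≤ m)
    (hr : ∀ x < r, r ≤ σ x)
    (hinc : ∀ x y, r ≤ x → x < y → r ≤ σ x → r ≤ σ y → σ x < σ y) : crossing m σ = r := by
  refine le_antisymm ?_ (le_crossing hrm hr)
  by_contra! hlt
  have h := le_of_lt_crossing m σ
  obtain ⟨y, hy⟩ := hσ.exists_eq r
  have hry : r < y := by
    by_contra hyr
    have := h y (by omega)
    omega
  have := h r hlt
  have := hinc r y le_rfl hry (by omega) (by omega)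
  omega

lemma Avoids132.increasing_of_crossing {m : ℕ} {σ : ℕ → ℕ} (hσ : IsPermOn m σ)
    (h : Avoids132 σ) {x y : ℕ} (hx : crossing m σ ≤ x) (hxy : x < y)
    (hx' : crossing m σ ≤ σ x) (hy' : crossing m σ ≤ σ y) : σ x < σ y := by
  by_contra hlt
  have hne := hσ.ne hxy.ne
  have hy := hσ.lt_of_inversion hxy (by omega)
  have hr := le_of_lt_crossing m σ
  -- Maximality of the crossing supplies a small early entry `z`, the 1 of a 132 completed by the
  -- descent at `x`, `y`.
  obtain ⟨z, hz, hz'⟩ : ∃ z, z < crossing m σ + 1 ∧ σ z < crossing m σ + 1 := by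
    by_contra! hcon
    have := le_crossing (m := m) (by omega) hcon
    omega
  have hzx : z ≠ x := by
    rintro rfl
    omega
  have hne1 := hσ.ne hzx
  have hzy : z ≠ y := by omega
  have hne2 := hσ.ne hzy
  exact h z x y (by omega) hxy (by omega) (by omega)

/-- A 132 starting outside the block lies wholly in `σ`. One starting in the block or at the fixed
point either stays inside `S`, or needs a descent among later entries above the block; those
increase, by the choice of `crossing`. -/
lemma avoids132_glue {s m : ℕ} {S σ : ℕ → ℕ} (hS : IsPermOn s S) (hσ : IsPermOn m σ)
    (hS' : Avoids132 S) (hσ' : Avoids132 σ) : Avoids132 (glue (crossing m σ) s S σ) := by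
  have hr := le_of_lt_crossing m σ
  have hinc := fun x y => hσ'.increasing_of_crossing hσ (x := x) (y := y)
  set r := crossing m σ
  set π := glue r s S σ with hπ
  have hA : ∀ x < r, r + s < π x := fun x hx => by
    have := hr x hx
    rw [hπ, glue_of_lt hr hx]
    omega
  have hB : ∀ x, r ≤ x → x ≤ r + s → r ≤ π x ∧ π x ≤ r + s := fun x h1 h2 => by
    rcases h2.eq_or_lt with rfl | h2
    · rw [hπ, glue_fixed]
      omega
    · obtain ⟨y, rfl⟩ := Nat.exists_eq_add_of_le h1
      have := hS.lt (x := y) (by omega)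
      rw [hπ, glue_block (by omega)]
      omega
  have hC : ∀ x, x < r ∨ r + s < x → ∃ u, x = shift r s u := fun x hx => by
    rcases hx with hx | hx
    · exact ⟨x, by simp [shift, hx]⟩
    · refine ⟨x - (s + 1), ?_⟩
      rw [shift, if_neg (by omega)]
      omega
  have hD : ∀ x, r + s < x → π x < r ∨ r + s < π x := fun x hx => by
    obtain ⟨u, rfl⟩ := hC x (.inr hx)
    rw [hπ, glue_shift]
    unfold shift
    split_ifs <;> omega
  have hT : ∀ x y, r + s < x → x < y → r + s < π x → r + s < π y → π x < π y := by
    intro x y hx hxy h1 h2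
    obtain ⟨u, rfl⟩ := hC x (.inr hx)
    obtain ⟨v, rfl⟩ := hC y (.inr (by omega))
    rw [hπ, glue_shift] at *
    rw [glue_shift, shift_lt_shift]
    rw [shift_lt_shift] at hxy
    refine hinc u v ?_ hxy ?_ ?_
    all_goals
      unfold shift at *
      grind
  intro a b c hab hbc h1 h2
  have out : (a < r ∨ r + s < a) → (b < r ∨ r + s < b) → (c < r ∨ r + s < c) → False := by
    intro ha hb hc
    obtain ⟨u, rfl⟩ := hC a ha
    obtain ⟨v, rfl⟩ := hC b hb
    obtain ⟨w, rfl⟩ := hC c hc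
    rw [hπ, glue_shift, glue_shift, shift_lt_shift] at h1 h2
    rw [shift_lt_shift] at hab hbc
    exact hσ' u v w hab hbc h1 h2
  rcases lt_or_ge a r with ha | ha
  · have := hA a ha
    have hb := hB b
    have hc := hB c
    exact out (by omega) (by omega) (by omega)
  rcases lt_or_ge (r + s) a with ha' | ha'
  · exact out (by omega) (by omega) (by omega)
  have hBa := hB a ha ha'
  rcases lt_or_ge (r + s) c with hc | hc
  · have := hD c hc
    have hBb := hB b
    have := hT b c (by omega) hbc (by omega) (by omega)
    omega
  · have hcs : c ≠ r + s := by
      rintro rfl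
      have := hB b (by omega) (by omega)
      have : π (r + s) = r + s := glue_fixed
      omega
    obtain ⟨u, rfl⟩ := Nat.exists_eq_add_of_le ha
    obtain ⟨v, rfl⟩ := Nat.exists_eq_add_of_le (show r ≤ b by omega)
    obtain ⟨w, rfl⟩ := Nat.exists_eq_add_of_le (show r ≤ c by omega)
    exact hS' u v w (by omega) (by omega) ((block_lt_iff (by omega) (by omega)).2 h1)
      ((block_lt_iff (by omega) (by omega)).2 h2)

/-- The block structure of a `132`-avoiding permutation around a fixed point. -/
lemma Avoids132.exists_blocks {n i : ℕ} {π : ℕ → ℕ} (hπ : IsPermOn n π) (h : Avoids132 π)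
    (hi : π i = i) : ∃ r ≤ i, (∀ x < r, i < π x) ∧ (∀ x, r ≤ x → x < i → r ≤ π x ∧ π x < i) ∧
      ∀ x, i < x → π x < r ∨ i < π x := by
  classical
  have hex : ∃ x, π x ≤ i := ⟨i, hi.le⟩
  obtain ⟨r, hr, hmin⟩ : ∃ r, π r ≤ i ∧ ∀ x < r, i < π x :=
    ⟨Nat.find hex, Nat.find_spec hex, fun x hx => not_le.1 (Nat.find_min hex hx)⟩
  have hri : r ≤ i := by
    by_contra! hlt
    have := hmin i hlt
    omega
  have hlt : ∀ x, r ≤ x → x < i → π x < i := by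
    intro x hrx hxi
    by_contra hge
    -- A value above `i` here gives the 132 at `r`, `x`, `i`.
    have h1 := hπ.ne hxi.ne
    have h2 := hπ.ne (hrx.trans_lt hxi).ne
    have hrx' : r ≠ x := by
      rintro rfl
      omega
    exact h r x i (by omega) hxi (by omega) (by omega)
  have hge : ∀ x, r ≤ x → x < i → r ≤ π x := by
    intro x hrx hxi
    by_contra hxr
    -- Values in `[π x, i)` cannot occur after `i`, where they would form a 132 with `x` and `i`,
    -- nor before `r`; there are too many of them for the positions `[r, i)`.
    have := hπ.card_le (A := Finset.Ico r i) (B := Finset.Ico (π x) i) fun y hy => by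
      rw [Finset.mem_Ico] at *
      have h1 := hmin y
      have h2 : y ≠ i := by
        rintro rfl
        omega
      refine ⟨by omega, ?_⟩
      by_contra hyi
      have h3 := hπ.ne (show x ≠ y by omega)
      exact h x i y hxi (by omega) (by omega) (by omega)
    rw [Nat.card_Ico, Nat.card_Ico] at this
    omega
  refine ⟨r, hri, hmin, fun x h1 h2 => ⟨hge x h1 h2, hlt x h1 h2⟩, fun x hx => ?_⟩
  by_contra! hcon
  have hne := hπ.ne hx.ne
  have := hπ.mem_of_apply_mem (A := Finset.Ico r i) (B := Finset.Ico r i) (x := x)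
    (fun y hy => by
      rw [Finset.mem_Ico] at *
      exact ⟨hge y hy.1 hy.2, hlt y hy.1 hy.2⟩) le_rfl (by
      rw [Finset.mem_Ico]
      omega)
  rw [Finset.mem_Ico] at this
  omega

/-- The recursion for `132`, which is the one for `321`. -/
lemma count_avoids132 (n : ℕ) :
    count n Avoids132 = count n (fun f => Avoids132 f ∧ FixedFree n f) +
      ∑ s ∈ Finset.range n, count s (fun f => Avoids132 f ∧ FixedFree s f) *
        count (n - 1 - s) Avoids132 := by
  refine count_eq_add_sum Avoids132 crossing
    (fun m σ => ⟨crossing_le m σ, le_of_lt_crossing m σ⟩)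
    (fun s m S σ hS hσ h1 h2 => avoids132_glue hS hσ h1 h2) (fun n π i hπ h hin hi _ => ?_) n
  obtain ⟨r, hri, hA, hB, hC⟩ := h.exists_blocks hπ hi
  obtain ⟨s, rfl⟩ := Nat.exists_eq_add_of_le hri
  -- The `r` values below `r` all sit after the fixed point, which leaves room for an outer
  -- permutation of length at least `r`.
  have hrn : r + (r + s) < n := by
    have := hπ.card_le (A := Finset.Ico (r + s + 1) n) (B := Finset.range r) fun y hy => by
      rw [Finset.mem_range] at hy
      rw [Finset.mem_Ico]
      have h1 := hA y
      have h2 := hB y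
      have h3 := hπ.2 y
      have h4 : y ≠ r + s := by
        rintro rfl
        omega
      omega
    rw [Finset.card_range, Nat.card_Ico] at this
    omega
  obtain ⟨m, rfl⟩ : ∃ m, n = m + s + 1 := ⟨n - s - 1, by omega⟩
  obtain ⟨S, σ, hS, hσ, hr, rfl⟩ := exists_eq_glue hπ (by omega) hi hA
    (fun x hx => hB _ (by omega) (by omega)) hC
  -- A descent of `σ` among positions and values from `r` on would form a 132 with the fixed point.
  have hcr : crossing m σ = r := by
    refine crossing_eq hσ (by omega) hr fun x y hx hxy hx' hy' => ?_
    by_contra hlt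
    have hne := hσ.ne hxy.ne
    have e1 := glue_of_gt (s := s) (S := S) (σ := σ) hx
    have e2 := glue_of_gt (s := s) (S := S) (σ := σ) (hx.trans hxy.le)
    rw [if_neg (by omega)] at e1 e2
    exact h (r + s) (x + (s + 1)) (y + (s + 1)) (by omega) (by omega)
      (by rw [hi, e2]; omega) (by rw [e1, e2]; omega)
  exact ⟨s, m, S, σ, rfl, hS, hσ, h.block hS, h.outer, by rw [hcr], by rw [hcr]⟩

/-! ### Equinumerosity of 321- and 132-avoiders by first entry -/

/-- The permutation with first entry `v` whose other entries are in the relative order of `σ`. -/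
def cons (v : ℕ) (σ : ℕ → ℕ) : ℕ → ℕ
  | 0 => v
  | x + 1 => if σ x < v then σ x else σ x + 1

lemma cons_succ (v : ℕ) (σ : ℕ → ℕ) (x : ℕ) :
    cons v σ (x + 1) = if σ x < v then σ x else σ x + 1 := rfl

lemma cons_succ_lt_cons_succ {v : ℕ} {σ : ℕ → ℕ} {x y : ℕ} :
    cons v σ (x + 1) < cons v σ (y + 1) ↔ σ x < σ y := by
  rw [cons_succ, cons_succ]
  split_ifs <;> omega

lemma isPermOn_cons {n v : ℕ} {σ : ℕ → ℕ} (hσ : IsPermOn n σ) (hv : v ≤ n) :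
    IsPermOn (n + 1) (cons v σ) := by
  constructor
  · rintro (_ | x) (_ | y) h
    · rfl
    · rw [cons_succ, cons] at h
      split_ifs at h <;> omega
    · rw [cons_succ, cons] at h
      split_ifs at h <;> omega
    · have h1 := @cons_succ_lt_cons_succ v σ x y
      have h2 := @cons_succ_lt_cons_succ v σ y x
      have : σ x = σ y := by omega
      rw [hσ.1 this]
  · rintro (_ | x) hx
    · omega
    · rw [cons_succ, hσ.2 x (by omega), if_neg (by omega)]

lemma cons_injective {v w : ℕ} {σ τ : ℕ → ℕ} (h : cons v σ = cons w τ) : v = w ∧ σ = τ := by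
  have hv : v = w := congrFun h 0
  refine ⟨hv, funext fun x => ?_⟩
  have := congrFun h (x + 1)
  rw [cons_succ, cons_succ, hv] at this
  split_ifs at this <;> omega

lemma exists_eq_cons {n : ℕ} {π : ℕ → ℕ} (hπ : IsPermOn (n + 1) π) :
    ∃ v ≤ n, ∃ σ, IsPermOn n σ ∧ π = cons v σ := by
  have h0 := hπ.lt (Nat.succ_pos n)
  let σ : ℕ → ℕ := fun x => if π (x + 1) < π 0 then π (x + 1) else π (x + 1) - 1
  have hσ : ∀ x, (if σ x < π 0 then σ x else σ x + 1) = π (x + 1) := fun x => by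
    have : π (x + 1) ≠ π 0 := hπ.ne (Nat.succ_ne_zero x)
    simp only [σ]
    split_ifs <;> omega
  refine ⟨π 0, by omega, σ, ⟨fun x y h => ?_, fun x hx => ?_⟩, ?_⟩
  · have e := hσ x
    rw [h, hσ y] at e
    have := hπ.1 e
    omega
  · have := hπ.2 (x + 1) (by omega)
    simp only [σ]
    split_ifs <;> omega
  · ext (_ | x)
    · rfl
    · rw [cons_succ, hσ]

lemma count_succ (n : ℕ) (Q : (ℕ → ℕ) → Prop) :
    count (n + 1) Q = ∑ v ∈ Finset.range (n + 1), count n (fun σ => Q (cons v σ)) := by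
  let g : (Σ v : Fin (n + 1), {σ // IsPermOn n σ ∧ Q (cons v σ)}) →
      {f // IsPermOn (n + 1) f ∧ Q f} := fun p =>
    ⟨cons p.1 p.2.1, isPermOn_cons p.2.2.1 (Nat.lt_succ_iff.1 p.1.2), p.2.2.2⟩
  have hg : Function.Bijective g := by
    constructor
    · rintro ⟨⟨v, hv⟩, ⟨σ, hσ⟩⟩ ⟨⟨w, hw⟩, ⟨τ, hτ⟩⟩ h
      obtain ⟨e, rfl⟩ := cons_injective (congrArg Subtype.val h)
      dsimp only at e
      subst e
      rfl
    · rintro ⟨π, hπ, hQ⟩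
      obtain ⟨v, hv, σ, hσ, rfl⟩ := exists_eq_cons hπ
      exact ⟨⟨⟨v, by omega⟩, ⟨σ, hσ, hQ⟩⟩, rfl⟩
  rw [count, ← Nat.card_congr (Equiv.ofBijective g hg), Nat.card_sigma,
    ← Fin.sum_univ_eq_sum_range (fun v => count n (fun σ => Q (cons v σ)))]
  rfl

/-- The values below `h` occur in increasing order. -/
def IncBelow (h : ℕ) (f : ℕ → ℕ) : Prop :=
  ∀ a b, a < b → f a < h → f b < h → f a < f b

/-- The values from `t` on occur in increasing order. -/
def IncAbove (t : ℕ) (f : ℕ → ℕ) : Prop :=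
  ∀ a b, a < b → t ≤ f a → t ≤ f b → f a < f b

section cons

variable {n v : ℕ} {σ : ℕ → ℕ}

/-- The new first entry can only play the 3, so the smaller entries must increase. -/
lemma avoids321_cons (hσ : IsPermOn n σ) :
    Avoids321 (cons v σ) ↔ Avoids321 σ ∧ IncBelow v σ := by
  constructor
  · refine fun h => ⟨fun a b c hab hbc h1 h2 => h (a + 1) (b + 1) (c + 1) (by omega) (by omega)
      (cons_succ_lt_cons_succ.2 h1) (cons_succ_lt_cons_succ.2 h2), fun a b hab ha hb => ?_⟩
    by_contra hlt
    have hne := hσ.ne hab.ne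
    refine h 0 (a + 1) (b + 1) (by omega) (by omega) ?_ (cons_succ_lt_cons_succ.2 (by omega))
    rw [cons_succ, if_pos ha]
    exact ha
  · rintro ⟨h, hi⟩ a b c hab hbc h1 h2
    obtain ⟨b, rfl⟩ := Nat.exists_eq_succ_of_ne_zero (show b ≠ 0 by omega)
    obtain ⟨c, rfl⟩ := Nat.exists_eq_succ_of_ne_zero (show c ≠ 0 by omega)
    rw [Nat.succ_eq_add_one, Nat.succ_eq_add_one, cons_succ_lt_cons_succ] at h2
    rcases a with _ | a
    · have hb : σ b < v := by
        rw [Nat.succ_eq_add_one, cons_succ, cons] at h1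
        split_ifs at h1 <;> omega
      have := hi b c (by omega) hb (by omega)
      omega
    · exact h a b c (by omega) (by omega) (cons_succ_lt_cons_succ.1 h1) h2

/-- The new first entry can only play the 1, so the larger entries must increase; in `σ` these are
the values from `v` on. -/
lemma avoids132_cons (hσ : IsPermOn n σ) :
    Avoids132 (cons v σ) ↔ Avoids132 σ ∧ IncAbove v σ := by
  constructor
  · refine fun h => ⟨fun a b c hab hbc h1 h2 => h (a + 1) (b + 1) (c + 1) (by omega) (by omega)
      (cons_succ_lt_cons_succ.2 h1) (cons_succ_lt_cons_succ.2 h2), fun a b hab ha hb => ?_⟩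
    by_contra hlt
    have hne := hσ.ne hab.ne
    refine h 0 (a + 1) (b + 1) (by omega) (by omega) ?_ (cons_succ_lt_cons_succ.2 (by omega))
    rw [cons_succ, if_neg (by omega)]
    exact Nat.lt_succ_of_le hb
  · rintro ⟨h, hi⟩ a b c hab hbc h1 h2
    obtain ⟨b, rfl⟩ := Nat.exists_eq_succ_of_ne_zero (show b ≠ 0 by omega)
    obtain ⟨c, rfl⟩ := Nat.exists_eq_succ_of_ne_zero (show c ≠ 0 by omega)
    rw [Nat.succ_eq_add_one, Nat.succ_eq_add_one, cons_succ_lt_cons_succ] at h2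
    rcases a with _ | a
    · have hc : v ≤ σ c := by
        rw [Nat.succ_eq_add_one, cons_succ, cons] at h1
        split_ifs at h1 <;> omega
      have := hi b c (by omega) (by omega) hc
      omega
    · exact h a b c (by omega) (by omega) (cons_succ_lt_cons_succ.1 h1) h2

lemma incBelow_cons_of_le {h : ℕ} (hv : h ≤ v) (hi : IncBelow v σ) : IncBelow h (cons v σ) := by
  rintro (_ | a) (_ | b) hab h1 h2
  · omega
  · rw [cons] at h1
    omega
  · omega
  · rw [cons_succ_lt_cons_succ]
    rw [cons_succ] at h1 h2
    refine hi a b (by omega) ?_ ?_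
    · split_ifs at h1 <;> omega
    · split_ifs at h2 <;> omega

lemma incBelow_cons_zero {h : ℕ} : IncBelow h (cons 0 σ) ↔ IncBelow (h - 1) σ := by
  constructor
  · intro hi a b hab h1 h2
    have := hi (a + 1) (b + 1) (by omega)
    simp only [cons_succ, Nat.not_lt_zero, if_false] at this
    omega
  · rintro hi (_ | a) (_ | b) hab h1 h2
    · omega
    · simp [cons]
    · omega
    · rw [cons_succ_lt_cons_succ]
      simp only [cons_succ, Nat.not_lt_zero, if_false] at h1 h2
      exact hi a b (by omega) (by omega) (by omega)

/-- The value 0 comes after the leading `v`, and both are below `h`. -/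
lemma not_incBelow_cons {h : ℕ} (hσ : IsPermOn n σ) (hv : 0 < v) (hh : v < h) :
    ¬ IncBelow h (cons v σ) := by
  intro hi
  obtain ⟨x, hx⟩ := hσ.exists_eq 0
  have e : cons v σ (x + 1) = 0 := by
    rw [cons_succ, hx, if_pos hv]
  have := hi 0 (x + 1) (by omega) hh (by omega)
  omega

lemma incAbove_cons {t : ℕ} (hv : v ≤ t) (hi : IncAbove v σ) : IncAbove t (cons v σ) := by
  rintro (_ | a) (_ | b) hab h1 h2
  · omega
  · rw [cons] at *
    rw [cons_succ] at *
    split_ifs at * <;> omega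
  · omega
  · rw [cons_succ_lt_cons_succ]
    rw [cons_succ] at h1 h2
    refine hi a b (by omega) ?_ ?_
    · split_ifs at h1 <;> omega
    · split_ifs at h2 <;> omega

lemma not_incAbove_cons {t : ℕ} (hσ : IsPermOn n σ) (hv : t < v) :
    ¬ IncAbove t (cons v σ) := by
  intro hi
  obtain ⟨x, hx⟩ := hσ.exists_eq t
  have e : cons v σ (x + 1) = t := by
    rw [cons_succ, hx, if_pos hv]
  have := hi 0 (x + 1) (by omega) hv.le (by omega)
  rw [e, cons] at this
  omega

end cons

lemma count_avoids321_incBelow_succ (n h : ℕ) :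
    count (n + 1) (fun f => Avoids321 f ∧ IncBelow h f) =
      count n (fun f => Avoids321 f ∧ IncBelow (h - 1) f) + ∑ v ∈ Finset.range n,
        if h ≤ v + 1 then count n (fun f => Avoids321 f ∧ IncBelow (v + 1) f) else 0 := by
  rw [count_succ, Finset.sum_range_succ', add_comm]
  congr 1
  · refine count_congr fun σ hσ => ?_
    rw [avoids321_cons hσ, incBelow_cons_zero]
    have : IncBelow 0 σ := fun a b _ h _ => absurd h (Nat.not_lt_zero _)
    tauto
  · refine Finset.sum_congr rfl fun v hv => ?_
    split_ifs with hvh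
    · refine count_congr fun σ hσ => ?_
      rw [avoids321_cons hσ]
      exact ⟨fun h => h.1, fun h => ⟨h, incBelow_cons_of_le hvh h.2⟩⟩
    · exact count_eq_zero fun σ hσ h => not_incBelow_cons hσ (Nat.succ_pos v) (by omega) h.2

lemma count_avoids132_incAbove_succ (n t : ℕ) :
    count (n + 1) (fun f => Avoids132 f ∧ IncAbove t f) = ∑ v ∈ Finset.range (n + 1),
        if v ≤ t then count n (fun f => Avoids132 f ∧ IncAbove v f) else 0 := by
  rw [count_succ]
  refine Finset.sum_congr rfl fun v hv => ?_
  split_ifs with hvt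
  · refine count_congr fun σ hσ => ?_
    rw [avoids132_cons hσ]
    exact ⟨fun h => h.1, fun h => ⟨h, incAbove_cons hvt h.2⟩⟩
  · exact count_eq_zero fun σ hσ h => not_incAbove_cons hσ (by omega) h.2

/-- Absorbs the exceptional first entry 0 of the 321 recursion, turning it into a sum over all `v ≥
h - 1`; truncated subtraction covers `h = 0`. -/
lemma sum_range_ite_eq_add (g : ℕ → ℕ) (n h : ℕ) (hh : h ≤ n + 1) :
    (∑ v ∈ Finset.range (n + 1), if h ≤ v + 1 then g v else 0) =
      g (h - 1) + ∑ v ∈ Finset.range n, if h ≤ v + 1 then g (v + 1) else 0 := by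
  induction n with
  | zero =>
    obtain rfl | rfl : h = 0 ∨ h = 1 := by omega
    all_goals simp
  | succ n ih =>
    rw [Finset.sum_range_succ]
    rcases hh.eq_or_lt with rfl | hlt
    · rw [Finset.sum_eq_zero, Finset.sum_eq_zero]
      · simp
      · intro v hv
        rw [Finset.mem_range] at hv
        exact if_neg (by omega)
      · intro v hv
        rw [Finset.mem_range] at hv
        exact if_neg (by omega)
    · rw [ih (by omega), Finset.sum_range_succ (n := n), if_pos (by omega), if_pos (by omega)]
      ring

/-- Under `v ↦ n - v` the two first-entry recursions become the same: `v ≥ h - 1` turns into `n - v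
≤ n + 1 - h`. -/
lemma count_incBelow_eq_count_incAbove (n h : ℕ) (hh : h ≤ n) :
    count n (fun f => Avoids321 f ∧ IncBelow h f) =
      count n (fun f => Avoids132 f ∧ IncAbove (n - h) f) := by
  induction n generalizing h with
  | zero =>
    refine count_congr fun f hf => ?_
    have e : ∀ x, f x = x := fun x => hf.2 x (Nat.zero_le x)
    simp only [Avoids321, Avoids132, IncBelow, IncAbove, e]
    constructor <;> intro _ <;> constructor <;> intros <;> omega
  | succ n ih =>
    rw [count_avoids321_incBelow_succ, count_avoids132_incAbove_succ,
      ← sum_range_ite_eq_add (fun v => count n (fun f => Avoids321 f ∧ IncBelow v f)) n h hh,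
      ← Finset.sum_range_reflect]
    refine Finset.sum_congr rfl fun v hv => ?_
    rw [Finset.mem_range] at hv
    rw [ih _ (by omega)]
    have e : n - (n + 1 - 1 - v) = v := by omega
    rw [e]
    exact if_congr (by omega) rfl rfl

/-- At `h = 0` both extra conditions are automatic: no value is below 0, and the values from `n` on
are fixed. -/
lemma count_avoids321_eq_count_avoids132 (n : ℕ) : count n Avoids321 = count n Avoids132 := by
  have h := count_incBelow_eq_count_incAbove n 0 (Nat.zero_le n)
  have h1 : count n Avoids321 = count n (fun f => Avoids321 f ∧ IncBelow 0 f) :=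
    count_congr fun σ _ => ⟨fun h => ⟨h, fun a b _ h _ => absurd h (Nat.not_lt_zero _)⟩, And.left⟩
  have h2 : count n Avoids132 = count n (fun f => Avoids132 f ∧ IncAbove (n - 0) f) :=
    count_congr fun σ hσ => ⟨fun h => ⟨h, fun a b hab h1 h2 => by
      have ha := fun h : a < n => hσ.lt h
      have hb := fun h : b < n => hσ.lt h
      rw [hσ.2 a (by omega), hσ.2 b (by omega)]
      exact hab⟩, And.left⟩
  rw [h1, h2, h]

/-- Derangements avoiding `321` and `132` are equinumerous. -/
theorem count_fixedFree_avoids321_eq (n : ℕ) :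
    count n (fun f => Avoids321 f ∧ FixedFree n f) =
      count n (fun f => Avoids132 f ∧ FixedFree n f) := by
  induction n using Nat.strong_induction_on with
  | _ n ih =>
    have h1 := count_avoids321 n
    have h2 := count_avoids132 n
    rw [count_avoids321_eq_count_avoids132] at h1
    have h3 : ∑ s ∈ Finset.range n, count s (fun f => Avoids321 f ∧ FixedFree s f) *
        count (n - 1 - s) Avoids321 = ∑ s ∈ Finset.range n,
          count s (fun f => Avoids132 f ∧ FixedFree s f) * count (n - 1 - s) Avoids132 :=
      Finset.sum_congr rfl fun s hs => by
        rw [ih s (Finset.mem_range.1 hs), count_avoids321_eq_count_avoids132]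
    omega

/-! ### Return to permutations of `Fin n` -/

lemma contains_iff {n : ℕ} (π : Equiv.Perm (Fin n)) (α : Equiv.Perm (Fin 3)) :
    Contains π α ↔ ∃ a b c : Fin n, a < b ∧ b < c ∧
      (π a < π b ↔ α 0 < α 1) ∧ (π a < π c ↔ α 0 < α 2) ∧ (π b < π c ↔ α 1 < α 2) := by
  constructor
  · rintro ⟨i, hi, h⟩
    exact ⟨i 0, i 1, i 2, hi (by decide), hi (by decide), h 0 1, h 0 2, h 1 2⟩
  · rintro ⟨a, b, c, hab, hbc, h1, h2, h3⟩
    have key : ∀ {x y : Fin n} {u v : Fin 3}, x ≠ y → u ≠ v → (π x < π y ↔ α u < α v) →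
        (π y < π x ↔ α v < α u) := by
      intro x y u v hxy huv h
      have h4 := π.injective.ne hxy
      have h5 := α.injective.ne huv
      rw [← not_le, ← not_le, not_iff_not, h4.le_iff_lt, h5.le_iff_lt, h]
    refine ⟨![a, b, c], ?_, ?_⟩
    · intro x y hxy
      fin_cases x <;> fin_cases y <;> simp_all
      exact hab.trans hbc
    · have g1 := key hab.ne (by decide) h1
      have g2 := key (hab.trans hbc).ne (by decide) h2
      have g3 := key hbc.ne (by decide) h3
      intro x y
      fin_cases x <;> fin_cases y <;> simp [*]

lemma contains_p321 {n : ℕ} {π : Equiv.Perm (Fin n)} : Contains π p321 ↔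
    ∃ a b c, a < b ∧ b < c ∧ π b < π a ∧ π c < π b := by
  rw [contains_iff]
  refine exists_congr fun a => exists_congr fun b => exists_congr fun c =>
    and_congr_right fun hab => and_congr_right fun hbc => ?_
  have h1 := π.injective.ne hab.ne
  have h2 := π.injective.ne hbc.ne
  have h3 := π.injective.ne (hab.trans hbc).ne
  simp [p321]
  omega

lemma contains_p132 {n : ℕ} {π : Equiv.Perm (Fin n)} : Contains π p132 ↔
    ∃ a b c, a < b ∧ b < c ∧ π a < π c ∧ π c < π b := by
  rw [contains_iff]
  refine exists_congr fun a => exists_congr fun b => exists_congr fun c =>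
    and_congr_right fun hab => and_congr_right fun hbc => ?_
  have h1 := π.injective.ne hab.ne
  have h2 := π.injective.ne hbc.ne
  have h3 := π.injective.ne (hab.trans hbc).ne
  simp [p132]
  omega

lemma avoids321_extend {n : ℕ} (π : Equiv.Perm (Fin n)) :
    Avoids321 (extend π) ↔ ¬ Contains π p321 := by
  rw [contains_p321]
  constructor
  · rintro h ⟨a, b, c, hab, hbc, h1, h2⟩
    refine h a b c hab hbc ?_ ?_ <;> simpa [extend_val]
  · intro h a b c hab hbc h1 h2
    have hc := (isPermOn_extend π).lt_of_inversion hbc h2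
    refine h ⟨⟨a, by omega⟩, ⟨b, by omega⟩, ⟨c, hc⟩, hab, hbc, ?_, ?_⟩
    · rwa [extend_of_lt π (hbc.trans hc), extend_of_lt π (by omega)] at h1
    · rwa [extend_of_lt π (hbc.trans hc), extend_of_lt π hc] at h2

lemma avoids132_extend {n : ℕ} (π : Equiv.Perm (Fin n)) :
    Avoids132 (extend π) ↔ ¬ Contains π p132 := by
  rw [contains_p132]
  constructor
  · rintro h ⟨a, b, c, hab, hbc, h1, h2⟩
    refine h a b c hab hbc ?_ ?_ <;> simpa [extend_val]
  · intro h a b c hab hbc h1 h2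
    have hc := (isPermOn_extend π).lt_of_inversion hbc h2
    refine h ⟨⟨a, by omega⟩, ⟨b, by omega⟩, ⟨c, hc⟩, hab, hbc, ?_, ?_⟩
    · rwa [extend_of_lt π hc, extend_of_lt π (by omega)] at h1
    · rwa [extend_of_lt π (hbc.trans hc), extend_of_lt π hc] at h2

lemma fixedFree_extend {n : ℕ} (π : Equiv.Perm (Fin n)) :
    FixedFree n (extend π) ↔ π ∈ derangements (Fin n) := by
  constructor
  · intro h x e
    exact h x x.2 (by rw [extend_val, e])
  · intro h x hx e
    rw [extend_of_lt π hx] at e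
    exact h ⟨x, hx⟩ (Fin.ext e)

lemma d_singleton {m : ℕ} (n : ℕ) (α : Equiv.Perm (Fin m)) :
    d n {α} = {π : Equiv.Perm (Fin n) | π ∈ derangements (Fin n) ∧ ¬ Contains π α}.ncard := by
  simp [d, avoidingDerangements]

lemma d_p321_eq_d_p132 (n : ℕ) : d n {p321} = d n {p132} := by
  have h := count_fixedFree_avoids321_eq n
  rw [← ncard_perm_eq_count, ← ncard_perm_eq_count] at h
  simp only [avoids321_extend, avoids132_extend, fixedFree_extend] at h
  rw [d_singleton, d_singleton]
  simpa only [and_comm] using h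

/-! ### Symmetries preserving derangements -/

lemma d_eq_of_equiv {m n : ℕ} {α β : Equiv.Perm (Fin m)}
    (e : Equiv.Perm (Fin n) ≃ Equiv.Perm (Fin n))
    (hD : ∀ π, e π ∈ derangements (Fin n) ↔ π ∈ derangements (Fin n))
    (hC : ∀ π, Contains (e π) β ↔ Contains π α) : d n {α} = d n {β} := by
  rw [d_singleton, d_singleton, ← Nat.card_coe_set_eq, ← Nat.card_coe_set_eq]
  exact Nat.card_congr (e.subtypeEquiv fun π => by
    simp only [Set.mem_ofPred_eq, hD, hC])

/-- Reverse-complement preserves fixed points. -/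
lemma d_p132_eq_d_p213 (n : ℕ) : d n {p132} = d n {p213} := by
  have hC : ∀ π : Equiv.Perm (Fin n),
      Contains (Fin.revPerm.permCongr π) p213 ↔ Contains π p132 := by
    intro π
    rw [contains_p132, contains_iff]
    constructor
    · rintro ⟨a, b, c, hab, hbc, h1, h2, h3⟩
      refine ⟨c.rev, b.rev, a.rev, Fin.rev_lt_rev.2 hbc, Fin.rev_lt_rev.2 hab, ?_⟩
      have := π.injective.ne (Fin.rev_injective.ne hab.ne)
      simp [p213, Fin.rev_lt_rev] at h1 h2 h3
      omega
    · rintro ⟨a, b, c, hab, hbc, h1, h2⟩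
      refine ⟨c.rev, b.rev, a.rev, Fin.rev_lt_rev.2 hbc, Fin.rev_lt_rev.2 hab, ?_⟩
      simp [p213, Fin.rev_lt_rev]
      omega
  refine d_eq_of_equiv Fin.revPerm.permCongr (fun π => ?_) hC
  simp only [derangements, Set.mem_ofPred_eq, Equiv.permCongr_apply]
  exact ⟨fun h x e => h x.rev (by simp [e]), fun h x e => h x.rev (by
    simpa [Fin.rev_eq_iff] using e)⟩

/-- Inversion preserves fixed points. -/
lemma d_p231_eq_d_p312 (n : ℕ) : d n {p231} = d n {p312} := by
  have hC : ∀ π : Equiv.Perm (Fin n), Contains π⁻¹ p312 ↔ Contains π p231 := by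
    intro π
    rw [contains_iff, contains_iff]
    constructor
    · rintro ⟨a, b, c, hab, hbc, h1, h2, h3⟩
      -- Inversion exchanges positions and values: the values of the 312, sorted increasingly, are
      -- the positions of the 231.
      refine ⟨π⁻¹ b, π⁻¹ c, π⁻¹ a, ?_⟩
      have : π.symm a ≠ π.symm b := π.symm.injective.ne hab.ne
      have : π.symm a ≠ π.symm c := π.symm.injective.ne (hab.trans hbc).ne
      simp [p312, p231] at h1 h2 h3 ⊢
      omega
    · rintro ⟨a, b, c, hab, hbc, h1, h2, h3⟩
      refine ⟨π c, π a, π b, ?_⟩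
      have := π.injective.ne hbc.ne
      have := π.injective.ne (hab.trans hbc).ne
      simp [p312, p231] at h1 h2 h3 ⊢
      omega
  refine d_eq_of_equiv (Equiv.inv _) (fun π => ?_) hC
  simp only [derangements, Set.mem_ofPred_eq, Equiv.inv_apply]
  exact ⟨fun h x e => h x (by rw [Equiv.Perm.inv_eq_iff_eq, e]),
    fun h x e => h x (by rw [Equiv.Perm.inv_eq_iff_eq] at e; exact e.symm)⟩

/-! ### Small values and separation of the classes -/

/-- A decidable form of the count, for evaluation by the kernel. -/
lemma d_eq_card (n : ℕ) (α : Equiv.Perm (Fin 3)) :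
    d n {α} = (Finset.univ.filter fun π : Equiv.Perm (Fin n) => (∀ x, π x ≠ x) ∧
      ¬ ∃ a b c : Fin n, a < b ∧ b < c ∧
      (π a < π b ↔ α 0 < α 1) ∧ (π a < π c ↔ α 0 < α 2) ∧ (π b < π c ↔ α 1 < α 2)).card := by
  rw [d_singleton, ← Set.ncard_coe_finset]
  congr 1
  ext π
  simp [contains_iff, derangements]

lemma d_three_p321 : d 3 {p321} = 2 := by
  rw [d_eq_card]
  decide +kernel

lemma d_three_p231 : d 3 {p231} = 1 := by
  rw [d_eq_card]
  decide +kernel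

lemma d_three_p123 : d 3 {p123} = 2 := by
  rw [d_eq_card]
  decide +kernel

lemma d_four_p321 : d 4 {p321} = 6 := by
  rw [d_eq_card]
  decide +kernel

lemma d_four_p123 : d 4 {p123} = 7 := by
  rw [d_eq_card]
  decide +kernel

lemma perm_three_cases : ∀ α : Equiv.Perm (Fin 3), α = p123 ∨ α = p132 ∨ α = p213 ∨ α = p231 ∨
    α = p312 ∨ α = p321 := by
  decide +kernel

lemma not_dWilf_p231_p321 : ¬ patternDWilf 3 p231 p321 := fun h => by
  have := h 3 le_rfl
  rw [d_three_p231, d_three_p321] at this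
  omega

lemma not_dWilf_p231_p123 : ¬ patternDWilf 3 p231 p123 := fun h => by
  have := h 3 le_rfl
  rw [d_three_p231, d_three_p123] at this
  omega

/-- Length 3 does not separate these two, as both counts are 2 there. -/
lemma not_dWilf_p321_p123 : ¬ patternDWilf 3 p321 p123 := fun h => by
  have := h 4 (by norm_num)
  rw [d_four_p321, d_four_p123] at this
  omega

lemma dWilf_p132_p321 : patternDWilf 3 p132 p321 := fun n _ => (d_p321_eq_d_p132 n).symm

lemma dWilf_p213_p321 : patternDWilf 3 p213 p321 := fun n _ =>
  ((d_p321_eq_d_p132 n).trans (d_p132_eq_d_p213 n)).symm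

lemma dWilf_p312_p231 : patternDWilf 3 p312 p231 := fun n _ => (d_p231_eq_d_p312 n).symm

/-! ### The three classes -/

lemma class_p321 : {α | patternDWilf 3 α p321} = {p132, p213, p321} := by
  ext α
  simp only [Set.mem_ofPred_eq, Set.mem_insert_iff, Set.mem_singleton_iff]
  constructor
  · intro h
    rcases perm_three_cases α with rfl | rfl | rfl | rfl | rfl | rfl
    · exact absurd (Setoid.symm' _ h) not_dWilf_p321_p123
    · simp
    · simp
    · exact absurd h not_dWilf_p231_p321
    · exact absurd (Setoid.trans' _ (Setoid.symm' _ dWilf_p312_p231) h) not_dWilf_p231_p321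
    · simp
  · rintro (rfl | rfl | rfl)
    · exact dWilf_p132_p321
    · exact dWilf_p213_p321
    · exact Setoid.refl' _ _

lemma class_p231 : {α | patternDWilf 3 α p231} = {p231, p312} := by
  ext α
  simp only [Set.mem_ofPred_eq, Set.mem_insert_iff, Set.mem_singleton_iff]
  constructor
  · intro h
    rcases perm_three_cases α with rfl | rfl | rfl | rfl | rfl | rfl
    · exact absurd (Setoid.symm' _ h) not_dWilf_p231_p123
    · exact absurd (Setoid.trans' _ (Setoid.symm' _ h) dWilf_p132_p321) not_dWilf_p231_p321
    · exact absurd (Setoid.trans' _ (Setoid.symm' _ h) dWilf_p213_p321) not_dWilf_p231_p321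
    · simp
    · simp
    · exact absurd (Setoid.symm' _ h) not_dWilf_p231_p321
  · rintro (rfl | rfl)
    · exact Setoid.refl' _ _
    · exact dWilf_p312_p231

lemma class_p123 : {α | patternDWilf 3 α p123} = {p123} := by
  ext α
  simp only [Set.mem_ofPred_eq, Set.mem_singleton_iff]
  constructor
  · intro h
    rcases perm_three_cases α with rfl | rfl | rfl | rfl | rfl | rfl
    · rfl
    · exact absurd (Setoid.trans' _ (Setoid.symm' _ dWilf_p132_p321) h) not_dWilf_p321_p123
    · exact absurd (Setoid.trans' _ (Setoid.symm' _ dWilf_p213_p321) h) not_dWilf_p321_p123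
    · exact absurd h not_dWilf_p231_p123
    · exact absurd (Setoid.trans' _ (Setoid.symm' _ dWilf_p312_p231) h) not_dWilf_p231_p123
    · exact absurd h not_dWilf_p321_p123
  · rintro rfl
    exact Setoid.refl' _ _

/-- A class is determined by any of its members. -/
lemma class_eq_of_rel {m : ℕ} {α β : Equiv.Perm (Fin m)} (h : patternDWilf m α β) :
    {γ | patternDWilf m γ α} = {γ | patternDWilf m γ β} :=
  Set.ext fun _ => ⟨fun k => Setoid.trans' _ k h, fun k => Setoid.trans' _ k (Setoid.symm' _ h)⟩

lemma classes_patternDWilf_three :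
    (patternDWilf 3).classes = {{p132, p213, p321}, {p231, p312}, {p123}} := by
  rw [← class_p321, ← class_p231, ← class_p123]
  ext s
  simp only [Set.mem_insert_iff, Set.mem_singleton_iff]
  constructor
  · rintro ⟨α, rfl⟩
    rcases perm_three_cases α with rfl | rfl | rfl | rfl | rfl | rfl
    · exact .inr (.inr rfl)
    · exact .inl (class_eq_of_rel dWilf_p132_p321)
    · exact .inl (class_eq_of_rel dWilf_p213_p321)
    · exact .inr (.inl rfl)
    · exact .inr (.inl (class_eq_of_rel dWilf_p312_p231))
    · exact .inl rfl
  · rintro (rfl | rfl | rfl) <;> exact Setoid.mem_classes _ _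

lemma ncard_classes_patternDWilf_three : (patternDWilf 3).classes.ncard = 3 := by
  have h1 : p321 ≠ p231 := by decide
  have h2 : p321 ≠ p312 := by decide
  have h3 : p321 ≠ p123 := by decide
  have h4 : p231 ≠ p123 := by decide
  rw [classes_patternDWilf_three, Set.ncard_eq_three]
  refine ⟨_, _, _, fun h => ?_, fun h => ?_, fun h => ?_, rfl⟩
  · have : p321 ∈ ({p231, p312} : Set (Equiv.Perm (Fin 3))) := h ▸ by simp
    simp [h1, h2] at this
  · have : p321 ∈ ({p123} : Set (Equiv.Perm (Fin 3))) := h ▸ by simp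
    simp [h3] at this
  · have : p231 ∈ ({p123} : Set (Equiv.Perm (Fin 3))) := h ▸ by simp
    simp [h4] at this

end RestrictedDerangements

theorem theorem6p2 :
    (RestrictedDerangements.patternDWilf 3).classes =
        {{RestrictedDerangements.p132, RestrictedDerangements.p213, RestrictedDerangements.p321},
          {RestrictedDerangements.p231, RestrictedDerangements.p312},
          {RestrictedDerangements.p123}} ∧
      (RestrictedDerangements.patternDWilf 3).classes.ncard = 3 := by
  exact ⟨RestrictedDerangements.classes_patternDWilf_three,
    RestrictedDerangements.ncard_classes_patternDWilf_three⟩
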